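/- Let $\mathcal H$ be a finite-dimensional real Hilbert space and let $f,g\colon\mathcal H\to\,]-\infty,+\infty]$ be proper lower semicontinuous convex functions, with effective domains $\operatorname{dom}f$, $\operatorname{dom}g$, Fenchel conjugates $f^*$, $g^*$, and proximity operators $\operatorname{prox}_f$, $\operatorname{prox}_g$, where $\operatorname{prox}_f(x)=\operatorname{argmin}_{y}\big(f(y)+\tfrac12\|y-x\|^2\big)$. Let $v_p$ and $v_d$ be the elements of minimum norm of $\overline{\operatorname{dom}f-\operatorname{dom}g}$ and of $\overline{\operatorname{dom}f^*+\operatorname{dom}g^*}$, respectively. Given any $s_0\in\mathcal H$, let the Douglas–Rachford iterates be defined for $n\ge 0$ by $$x_n=\operatorname{prox}_f s_n,\qquad \nu_n=s_n-x_n,\qquad \tilde x_n=\operatorname{prox}_g(2x_n-s_n),\qquad s_{n+1}=s_n+\tilde x_n-x_n.$$ Then, as $n\to\infty$, $$x_n-x_{n+1}\to v_d,\qquad \tilde x_n-\tilde x_{n+1}\to v_d,\qquad \nu_n-\nu_{n+1}\to v_p.$$ Moreover, $v_p$ and $v_d$ are certificates of strong infeasibility: if $v_p\neq 0$, then the primal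 problem $\min_x f(x)+g(x)$ is strongly infeasible, i.e. $0\notin\overline{\operatorname{dom}f-\operatorname{dom}g}$; if $v_d\ne 0$, then the dual problem $\min_\nu f^*(\nu)+g^*(-\nu)$ is strongly infeasible, i.e. $0\notin\overline{\operatorname{dom}f^*+\operatorname{dom}g^*}$. No feasibility assumption is made on either problem. -/

import Mathlib

open Filter Topology
open scoped Pointwise

noncomputable section

namespace DouglasRachford

variable {H : Type*} [NormedAddCommGroup H] [InnerProductSpace ℝ H]

/-- `f` is a proper lower semicontinuous convex function `H → ]-∞, +∞]`
(convexity is convexity of the epigraph). -/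
structure IsProperLscConvex (f : H → EReal) : Prop where
  ne_bot : ∀ x, f x ≠ ⊥
  exists_ne_top : ∃ x, f x ≠ ⊤
  lsc : LowerSemicontinuous f
  convex : Convex ℝ {p : H × ℝ | f p.1 ≤ (p.2 : EReal)}

/-- The (effective) domain of `f`. -/
def dom (f : H → EReal) : Set H := {x | f x < ⊤}

/-- The Fenchel conjugate of `f`. -/
def conj (f : H → EReal) : H → EReal :=
  fun u => ⨆ x : H, (((inner ℝ x u : ℝ) : EReal) - f x)

/-- The proximity operator: the minimizer of `y ↦ f y + ½ ‖y - x‖²` over `H`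
(it exists and is unique for proper lower semicontinuous convex `f`). -/
def prox (f : H → EReal) (x : H) : H :=
  Classical.epsilon fun p : H =>
    IsMinOn (fun y : H => f y + ((1 / 2 * ‖y - x‖ ^ 2 : ℝ) : EReal)) Set.univ p

/-- The projection onto `C`: the point of `C` that is nearest to `x`
(it exists and is unique for nonempty closed convex `C`). -/
def proj (C : Set H) (x : H) : H :=
  Classical.epsilon fun p : H => p ∈ C ∧ IsMinOn (fun y : H => ‖y - x‖) C p

/-- The problem of minimizing `f + g` is strongly infeasible. -/
def StronglyInfeasible (f g : H → EReal) : Prop := (0 : H) ∉ closure (dom f - dom g)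

/-- The vector `v_p`. -/
def vp (f g : H → EReal) : H := proj (closure (dom f - dom g)) 0

/-- The vector `v_d`. -/
def vd (f g : H → EReal) : H := proj (closure (dom (conj f) + dom (conj g))) 0

end DouglasRachford

end

/-!
Write `T` for the Douglas–Rachford operator and, for `s : H`, `x = prox_f s`,
`x̃ = prox_g (2 x - s)`. Then `u = s - x` and `ũ = 2 x - s - x̃` are subgradients of `f` at `x` and
of `g` at `x̃`, and the displacement has the two expressions `s - T s = x - x̃ = u + ũ`. It lies in
`D = dom f - dom g` and in `R = dom f* + dom g*`.

The variational inequalities for the minimum-norm points `v_p` of `closure D` and `v_d` of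
`closure R`, together with the orthogonality `⟪v_p, v_d⟫ = 0` (`inner_vp_vd`), show that every
displacement `z` satisfies `‖v‖² ≤ ⟪z, v⟫` for `v = v_p + v_d`. In particular
`‖z - v‖² ≤ ‖z‖² - ‖v‖²`, so `z` is close to `v` as soon as its norm is close to `‖v‖`.

The main point is that `v` is a limit of displacements (`exists_seq_sub_drStep_tendsto`). The
contraction `T / (1 + δ)` has a fixed point `s_δ`, for which `s_δ - T s_δ = -δ s_δ`. The subgradient
and Fenchel–Young inequalities at fixed test points `a ∈ dom f`, `b ∈ dom g`, `u' ∈ dom f*`,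
`w' ∈ dom g*`, multiplied by `δ → 0`, leave an inequality that depends only on the cluster points
of `δ s_δ`, `δ x_δ`, and on `a - b` and `u' + w'` (`regularized_limit_ineq`). Hence `a - b` may be
replaced by `v_p` and, independently, `u' + w'` by `v_d`, which forces the cluster point of the
displacements `-δ s_δ` to be `v`. No relative interiors or qualification conditions enter.

Since `T` is firmly nonexpansive, the displacements along two orbits are asymptotically equal and
their norms do not increase along an orbit; comparison with orbits started at points of nearly
minimal displacement gives `s n - s (n + 1) → v` for every orbit (`tendsto_sub_drStep`).

Finally this displacement is split as `a n + b n` with `a n = x n - x (n + 1)` and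
`b n = ν n - ν (n + 1)`. The firm nonexpansiveness identity yields `⟪a n, b n⟫ → 0`. The bounds
`⟪x m - x̃ n, v_p⟫ ≥ ‖v_p‖²` become tight for `m = n → ∞`, so `⟪a n, v_p⟫ → 0`, and likewise
`⟪b n, v_d⟫ → 0`. Expanding the square gives `‖a n - v_d‖² → 0` (`tendsto_prox_sub`).
-/

noncomputable section

namespace DouglasRachford

variable {H : Type*} [NormedAddCommGroup H] [InnerProductSpace ℝ H]

/-! ### Subgradients, proximity operators and minimum-norm points -/

/-- `u` is a subgradient of `f` at `p`, and `f p < ⊤`. The inequality is between the real values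
of `f` on its domain, so the notion is meant for functions that never take the value `⊥`. -/
def IsSubgrad (f : H → EReal) (p u : H) : Prop :=
  p ∈ dom f ∧ ∀ y ∈ dom f, (f p).toReal + inner ℝ (y - p) u ≤ (f y).toReal

theorem nonneg_of_forall_add_mul_nonneg {a b : ℝ}
    (h : ∀ t : ℝ, 0 < t → t ≤ 1 → 0 ≤ a + t * b) : 0 ≤ a := by
  have h1 : Tendsto (fun t : ℝ => a + t * b) (𝓝[>] 0) (𝓝 a) := by
    have : Continuous fun t : ℝ => a + t * b := by fun_prop
    simpa using (this.tendsto 0).mono_left nhdsWithin_le_nhds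
  refine ge_of_tendsto h1 ?_
  filter_upwards [Ioc_mem_nhdsGT (zero_lt_one (α := ℝ))] with t ht using h t ht.1 ht.2

theorem IsProperLscConvex.coe_toReal {f : H → EReal} (hf : IsProperLscConvex f) {y : H}
    (hy : y ∈ dom f) : ((f y).toReal : EReal) = f y :=
  EReal.coe_toReal (ne_of_lt hy) (hf.ne_bot y)

theorem IsProperLscConvex.dom_nonempty {f : H → EReal} (hf : IsProperLscConvex f) :
    (dom f).Nonempty := by
  obtain ⟨x, hx⟩ := hf.exists_ne_top
  exact ⟨x, lt_top_iff_ne_top.2 hx⟩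

theorem IsProperLscConvex.le_combo {f : H → EReal} (hf : IsProperLscConvex f) {y z : H}
    (hy : y ∈ dom f) (hz : z ∈ dom f) {a b : ℝ} (ha : 0 ≤ a) (hb : 0 ≤ b) (hab : a + b = 1) :
    f (a • y + b • z) ≤ ((a * (f y).toReal + b * (f z).toReal : ℝ) : EReal) := by
  have h := hf.convex (x := (y, (f y).toReal)) (by simp [hf.coe_toReal hy])
    (y := (z, (f z).toReal)) (by simp [hf.coe_toReal hz]) ha hb hab
  simpa using h

theorem IsProperLscConvex.combo_mem_dom {f : H → EReal} (hf : IsProperLscConvex f) {y z : H}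
    (hy : y ∈ dom f) (hz : z ∈ dom f) {a b : ℝ} (ha : 0 ≤ a) (hb : 0 ≤ b) (hab : a + b = 1) :
    a • y + b • z ∈ dom f :=
  (hf.le_combo hy hz ha hb hab).trans_lt (EReal.coe_lt_top _)

theorem IsProperLscConvex.toReal_combo_le {f : H → EReal} (hf : IsProperLscConvex f) {y z : H}
    (hy : y ∈ dom f) (hz : z ∈ dom f) {a b : ℝ} (ha : 0 ≤ a) (hb : 0 ≤ b) (hab : a + b = 1) :
    (f (a • y + b • z)).toReal ≤ a * (f y).toReal + b * (f z).toReal := by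
  have h := hf.le_combo hy hz ha hb hab
  rw [← hf.coe_toReal (hf.combo_mem_dom hy hz ha hb hab)] at h
  exact EReal.coe_le_coe_iff.1 h

theorem IsProperLscConvex.convex_dom {f : H → EReal} (hf : IsProperLscConvex f) :
    Convex ℝ (dom f) :=
  fun _ hy _ hz _ _ ha hb hab => hf.combo_mem_dom hy hz ha hb hab

/-- A proper lower semicontinuous convex function decreases at most linearly: on the unit ball
about a point `x₀` of its domain it has a minimum, by compactness, and convexity along rays from
`x₀` propagates this lower bound. -/
theorem IsProperLscConvex.exists_linear_lower_bound [FiniteDimensional ℝ H] {f : H → EReal}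
    (hf : IsProperLscConvex f) {x₀ : H} (hx₀ : x₀ ∈ dom f) :
    ∃ m K : ℝ, 0 ≤ K ∧ ∀ y ∈ dom f, m - K * ‖y - x₀‖ ≤ (f y).toReal := by
  obtain ⟨p, hpB, hp⟩ := LowerSemicontinuousOn.exists_isMinOn
    (⟨x₀, by simp⟩ : (Metric.closedBall x₀ 1).Nonempty)
    (isCompact_closedBall x₀ 1) (hf.lsc.lowerSemicontinuousOn _)
  have hpx : f p ≤ f x₀ := hp (by simp)
  have hpd : p ∈ dom f := hpx.trans_lt hx₀
  have hmin : ∀ y ∈ dom f, ‖y - x₀‖ ≤ 1 → (f p).toReal ≤ (f y).toReal := by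
    intro y hy hy1
    have h : f p ≤ f y := hp (by simpa [dist_eq_norm] using hy1)
    rw [← hf.coe_toReal hpd, ← hf.coe_toReal hy] at h
    exact EReal.coe_le_coe_iff.1 h
  have hK := hmin x₀ hx₀ (by simp)
  refine ⟨(f p).toReal, (f x₀).toReal - (f p).toReal, by linarith, fun y hy => ?_⟩
  rcases le_or_gt ‖y - x₀‖ 1 with h | h
  · nlinarith [hmin y hy h, norm_nonneg (y - x₀)]
  · set r := ‖y - x₀‖ with hr
    have hr0 : 0 < r := by linarith
    have hri : 0 ≤ 1 - r⁻¹ := by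
      have := inv_le_one_of_one_le₀ h.le
      linarith
    have h1 := hf.toReal_combo_le hx₀ hy hri (inv_nonneg.2 hr0.le) (by ring)
    have h2 := hmin _ (hf.combo_mem_dom hx₀ hy hri (inv_nonneg.2 hr0.le) (by ring)) (by
      have : (1 - r⁻¹) • x₀ + r⁻¹ • y - x₀ = r⁻¹ • (y - x₀) := by module
      rw [this, norm_smul, ← hr, Real.norm_of_nonneg (inv_nonneg.2 hr0.le),
        inv_mul_cancel₀ hr0.ne'])
    have h3 := mul_le_mul_of_nonneg_left (h2.trans h1) hr0.le
    have h4 : r * ((1 - r⁻¹) * (f x₀).toReal + r⁻¹ * (f y).toReal)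
        = (r - 1) * (f x₀).toReal + (f y).toReal := by field_simp
    rw [h4] at h3
    nlinarith

theorem exists_isMinOn_prox [FiniteDimensional ℝ H] {f : H → EReal}
    (hf : IsProperLscConvex f) (x : H) :
    ∃ p : H, IsMinOn (fun y : H => f y + ((1 / 2 * ‖y - x‖ ^ 2 : ℝ) : EReal)) Set.univ p := by
  obtain ⟨x₀, hx₀⟩ := hf.dom_nonempty
  obtain ⟨m, K, hK, hm⟩ := hf.exists_linear_lower_bound hx₀
  have hlsc : LowerSemicontinuous
      (fun y : H => f y + ((1 / 2 * ‖y - x‖ ^ 2 : ℝ) : EReal)) := by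
    refine hf.lsc.add' (Continuous.lowerSemicontinuous ?_) fun y =>
      EReal.continuousAt_add (Or.inr (EReal.coe_ne_bot _)) (Or.inr (EReal.coe_ne_top _))
    exact continuous_coe_real_ereal.comp (by fun_prop)
  -- Outside the ball of radius `R` about `x`, the objective exceeds its value at `x₀`.
  set D : ℝ := (f x₀).toReal + 1 / 2 * ‖x₀ - x‖ ^ 2 - m + K * ‖x - x₀‖ with hD
  set R : ℝ := 2 * K + 1 + 2 * |D| + ‖x₀ - x‖ with hR
  have hxB : x₀ ∈ Metric.closedBall x R := by
    rw [Metric.mem_closedBall, dist_eq_norm]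
    have := abs_nonneg D
    linarith
  obtain ⟨p, -, hp⟩ := LowerSemicontinuousOn.exists_isMinOn ⟨x₀, hxB⟩
    (isCompact_closedBall x R) (hlsc.lowerSemicontinuousOn _)
  refine ⟨p, fun y _ => ?_⟩
  by_cases hyB : y ∈ Metric.closedBall x R
  · exact hp hyB
  refine le_trans (b := f x₀ + ((1 / 2 * ‖x₀ - x‖ ^ 2 : ℝ) : EReal)) (hp hxB) ?_
  change f x₀ + ((1 / 2 * ‖x₀ - x‖ ^ 2 : ℝ) : EReal) ≤ f y + ((1 / 2 * ‖y - x‖ ^ 2 : ℝ) : EReal)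
  by_cases hy : y ∈ dom f
  · rw [← hf.coe_toReal hx₀, ← hf.coe_toReal hy, ← EReal.coe_add, ← EReal.coe_add,
      EReal.coe_le_coe_iff]
    rw [Metric.mem_closedBall, dist_eq_norm, not_le] at hyB
    have h1 := hm y hy
    have h2 : ‖y - x₀‖ ≤ ‖y - x‖ + ‖x - x₀‖ := norm_sub_le_norm_sub_add_norm_sub _ _ _
    have h3 := mul_le_mul_of_nonneg_left h2 hK
    have h4 := le_abs_self D
    have h5 := abs_nonneg D
    have h6 := norm_nonneg (x₀ - x)
    have h7 : |D| ≤ ‖y - x‖ * (1 / 2 * ‖y - x‖ - K) := by nlinarith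
    nlinarith
  · have : f y = ⊤ := by
      by_contra h
      exact hy (lt_top_iff_ne_top.2 h)
    rw [this, EReal.top_add_coe]
    exact le_top

theorem isSubgrad_prox [FiniteDimensional ℝ H] {f : H → EReal}
    (hf : IsProperLscConvex f) (x : H) : IsSubgrad f (prox f x) (x - prox f x) := by
  have hp : IsMinOn (fun y : H => f y + ((1 / 2 * ‖y - x‖ ^ 2 : ℝ) : EReal)) Set.univ
      (prox f x) := Classical.epsilon_spec (exists_isMinOn_prox hf x)
  set p := prox f x
  have hmin : ∀ y, f p + ((1 / 2 * ‖p - x‖ ^ 2 : ℝ) : EReal)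
      ≤ f y + ((1 / 2 * ‖y - x‖ ^ 2 : ℝ) : EReal) := fun y => hp (Set.mem_univ y)
  have hpd : p ∈ dom f := by
    obtain ⟨x₀, hx₀⟩ := hf.dom_nonempty
    have h := hmin x₀
    rw [← hf.coe_toReal hx₀, ← EReal.coe_add] at h
    refine lt_top_iff_ne_top.2 fun (htop : f p = ⊤) => ?_
    rw [htop, EReal.top_add_coe] at h
    exact EReal.coe_ne_top _ (top_le_iff.1 h)
  have hreal : ∀ y ∈ dom f, (f p).toReal + 1 / 2 * ‖p - x‖ ^ 2
      ≤ (f y).toReal + 1 / 2 * ‖y - x‖ ^ 2 := by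
    intro y hy
    have h := hmin y
    rwa [← hf.coe_toReal hy, ← hf.coe_toReal hpd, ← EReal.coe_add, ← EReal.coe_add,
      EReal.coe_le_coe_iff] at h
  refine ⟨hpd, fun y hy => ?_⟩
  have key : 0 ≤ (f y).toReal - (f p).toReal - inner ℝ (y - p) (x - p) := by
    refine nonneg_of_forall_add_mul_nonneg (b := 1 / 2 * ‖y - p‖ ^ 2) fun t ht ht1 => ?_
    have h1 := hf.toReal_combo_le hpd hy (sub_nonneg.2 ht1) ht.le (by ring)
    have h2 := hreal _ (hf.combo_mem_dom hpd hy (sub_nonneg.2 ht1) ht.le (by ring))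
    have h3 : (1 - t) • p + t • y - x = t • (y - p) - (x - p) := by module
    rw [h3, norm_sub_rev p x, norm_sub_sq_real (t • (y - p)), norm_smul, inner_smul_left, mul_pow,
      Real.norm_eq_abs, sq_abs] at h2
    simp only [conj_trivial] at h2
    refine nonneg_of_mul_nonneg_right (a := t) ?_ ht
    nlinarith
  linarith

/-- Monotonicity of the subdifferential. -/
theorem IsSubgrad.inner_sub_nonneg {f : H → EReal} {p q u w : H}
    (hp : IsSubgrad f p u) (hq : IsSubgrad f q w) : 0 ≤ inner ℝ (p - q) (u - w) := by
  have h1 := hp.2 q hq.1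
  have h2 := hq.2 p hp.1
  rw [inner_sub_right]
  rw [← neg_sub p q, inner_neg_left] at h1
  linarith

theorem mem_dom_conj_iff {f : H → EReal} (hf : IsProperLscConvex f) {u : H} :
    u ∈ dom (conj f) ↔ ∃ c : ℝ, ∀ x ∈ dom f, inner ℝ x u - (f x).toReal ≤ c := by
  constructor
  · intro hu
    refine ⟨(conj f u).toReal, fun x hx => ?_⟩
    have h : ((inner ℝ x u : ℝ) : EReal) - f x ≤ conj f u :=
      le_iSup (fun x : H => ((inner ℝ x u : ℝ) : EReal) - f x) x
    rw [← hf.coe_toReal hx, ← EReal.coe_sub] at h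
    have hbot : conj f u ≠ ⊥ := fun hb => by
      rw [hb] at h
      exact EReal.coe_ne_bot _ (le_bot_iff.1 h)
    rw [← EReal.coe_toReal (ne_of_lt hu) hbot] at h
    exact EReal.coe_le_coe_iff.1 h
  · rintro ⟨c, hc⟩
    refine lt_of_le_of_lt (b := (c : EReal)) (iSup_le fun x => ?_) (EReal.coe_lt_top c)
    by_cases hx : x ∈ dom f
    · rw [← hf.coe_toReal hx, ← EReal.coe_sub, EReal.coe_le_coe_iff]
      exact hc x hx
    · have : f x = ⊤ := by
        by_contra h
        exact hx (lt_top_iff_ne_top.2 h)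
      simp [this]

theorem IsSubgrad.mem_dom_conj {f : H → EReal} (hf : IsProperLscConvex f) {p u : H}
    (h : IsSubgrad f p u) : u ∈ dom (conj f) := by
  refine (mem_dom_conj_iff hf).2 ⟨inner ℝ p u - (f p).toReal, fun x hx => ?_⟩
  have := h.2 x hx
  rw [inner_sub_left] at this
  linarith

theorem convex_dom_conj {f : H → EReal} (hf : IsProperLscConvex f) :
    Convex ℝ (dom (conj f)) := by
  intro u hu w hw a b ha hb hab
  obtain ⟨c, hc⟩ := (mem_dom_conj_iff hf).1 hu
  obtain ⟨d, hd⟩ := (mem_dom_conj_iff hf).1 hw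
  refine (mem_dom_conj_iff hf).2 ⟨a * c + b * d, fun x hx => ?_⟩
  have h1 := mul_le_mul_of_nonneg_left (hc x hx) ha
  have h2 := mul_le_mul_of_nonneg_left (hd x hx) hb
  have h3 : (f x).toReal = a * (f x).toReal + b * (f x).toReal := by rw [← add_mul, hab, one_mul]
  rw [inner_add_right, inner_smul_right, inner_smul_right]
  linarith

theorem dom_conj_nonempty [FiniteDimensional ℝ H] {f : H → EReal}
    (hf : IsProperLscConvex f) : (dom (conj f)).Nonempty :=
  ⟨_, (isSubgrad_prox hf 0).mem_dom_conj hf⟩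

/-- If `⟪·, d⟫` is bounded below on `dom f` then `-d` is a direction of recession of `dom f*`. -/
theorem sub_smul_mem_dom_conj {f : H → EReal} (hf : IsProperLscConvex f) {d u : H} {β : ℝ}
    (hβ : ∀ x ∈ dom f, β ≤ inner ℝ x d) (hu : u ∈ dom (conj f)) {t : ℝ} (ht : 0 ≤ t) :
    u - t • d ∈ dom (conj f) := by
  obtain ⟨c, hc⟩ := (mem_dom_conj_iff hf).1 hu
  refine (mem_dom_conj_iff hf).2 ⟨c - t * β, fun x hx => ?_⟩
  have h1 := hc x hx
  have h2 := mul_le_mul_of_nonneg_left (hβ x hx) ht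
  rw [inner_sub_right, inner_smul_right]
  linarith

/-- For fixed `a ∈ dom f` and `b ∈ dom f*`, the monotonicity inequality against the graph of the
subdifferential holds up to a constant, by the subgradient and the Fenchel–Young inequalities. -/
theorem exists_le_inner_sub {f : H → EReal} (hf : IsProperLscConvex f) {a b : H}
    (ha : a ∈ dom f) (hb : b ∈ dom (conj f)) :
    ∃ C : ℝ, ∀ p u, IsSubgrad f p u → C ≤ inner ℝ (a - p) (b - u) := by
  obtain ⟨c, hc⟩ := (mem_dom_conj_iff hf).1 hb
  refine ⟨inner ℝ a b - (f a).toReal - c, fun p u h => ?_⟩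
  have h1 := h.2 a ha
  have h2 := hc p h.1
  rw [inner_sub_right, inner_sub_left a p b]
  linarith

theorem proj_zero_spec [FiniteDimensional ℝ H] {C : Set H} (hC : IsClosed C)
    (hne : C.Nonempty) : proj C 0 ∈ C ∧ ∀ y ∈ C, ‖proj C 0‖ ≤ ‖y‖ := by
  have hex : ∃ p : H, p ∈ C ∧ IsMinOn (fun y : H => ‖y - 0‖) C p := by
    obtain ⟨p, hp, hd⟩ := hC.exists_infDist_eq_dist hne (0 : H)
    refine ⟨p, hp, fun y hy => ?_⟩
    have := Metric.infDist_le_dist_of_mem (x := (0 : H)) hy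
    rw [hd, dist_comm, dist_eq_norm, dist_comm, dist_eq_norm] at this
    exact this
  obtain ⟨h1, h2⟩ := Classical.epsilon_spec hex
  exact ⟨h1, fun y hy => by simpa [proj] using h2 hy⟩

theorem norm_proj_zero_sq_le_inner [FiniteDimensional ℝ H] {C : Set H} (hC : IsClosed C)
    (hne : C.Nonempty) (hconv : Convex ℝ C) {y : H} (hy : y ∈ C) :
    ‖proj C 0‖ ^ 2 ≤ inner ℝ y (proj C 0) := by
  obtain ⟨hp, hmin⟩ := proj_zero_spec hC hne
  set p := proj C 0
  have key : 0 ≤ 2 * inner ℝ (y - p) p := by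
    refine nonneg_of_forall_add_mul_nonneg (b := ‖y - p‖ ^ 2) fun t ht ht1 => ?_
    have h := hmin _ (hconv hp hy (sub_nonneg.2 ht1) ht.le (by ring))
    have h1 : (1 - t) • p + t • y = t • (y - p) + p := by module
    have h2 := pow_le_pow_left₀ (norm_nonneg _) h 2
    rw [h1, norm_add_sq_real, norm_smul, inner_smul_left, mul_pow, Real.norm_eq_abs, sq_abs] at h2
    simp only [conj_trivial] at h2
    refine nonneg_of_mul_nonneg_right (a := t) ?_ ht
    nlinarith
  rw [inner_sub_left, real_inner_self_eq_norm_sq] at key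
  linarith

theorem zero_notMem_of_proj_zero_ne [FiniteDimensional ℝ H] {C : Set H} (hC : IsClosed C)
    (h : proj C 0 ≠ 0) : (0 : H) ∉ C := fun h0 =>
  h (norm_le_zero_iff.1 (by simpa using (proj_zero_spec hC ⟨0, h0⟩).2 0 h0))

/-! ### The two infimal displacement vectors -/

theorem norm_vp_sq_le_inner [FiniteDimensional ℝ H] {f g : H → EReal}
    (hf : IsProperLscConvex f) (hg : IsProperLscConvex g) {d : H}
    (hd : d ∈ closure (dom f - dom g)) : ‖vp f g‖ ^ 2 ≤ inner ℝ d (vp f g) :=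
  norm_proj_zero_sq_le_inner isClosed_closure (hf.dom_nonempty.sub hg.dom_nonempty).closure
    (hf.convex_dom.sub hg.convex_dom).closure hd

theorem norm_vd_sq_le_inner [FiniteDimensional ℝ H] {f g : H → EReal}
    (hf : IsProperLscConvex f) (hg : IsProperLscConvex g) {r : H}
    (hr : r ∈ closure (dom (conj f) + dom (conj g))) : ‖vd f g‖ ^ 2 ≤ inner ℝ r (vd f g) :=
  norm_proj_zero_sq_le_inner isClosed_closure
    ((dom_conj_nonempty hf).add (dom_conj_nonempty hg)).closure
    ((convex_dom_conj hf).add (convex_dom_conj hg)).closure hr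

theorem nonpos_of_forall_le_sub_mul {A B c : ℝ} (h : ∀ t : ℝ, 0 ≤ t → A ≤ B - t * c) :
    c ≤ 0 := by
  by_contra! hc
  have h0 := h 0 le_rfl
  have h1 := h ((B - A + 1) / c) (div_nonneg (by linarith) hc.le)
  rw [div_mul_cancel₀ _ hc.ne'] at h1
  linarith

/-- `v_p` is orthogonal to `v_d`: the linear form `⟪·, v_p⟫` is bounded below on `dom f` and above
on `dom g`, so `-v_p` and `v_p` are directions of recession of `dom f*` and `dom g*`. Hence
`⟪·, v_d⟫`, which is bounded below on `dom f* + dom g*`, vanishes at `v_p`. -/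
theorem inner_vp_vd [FiniteDimensional ℝ H] {f g : H → EReal}
    (hf : IsProperLscConvex f) (hg : IsProperLscConvex g) :
    inner ℝ (vp f g) (vd f g) = 0 := by
  obtain ⟨a, ha⟩ := hf.dom_nonempty
  obtain ⟨b, hb⟩ := hg.dom_nonempty
  obtain ⟨u, hu⟩ := dom_conj_nonempty hf
  obtain ⟨w, hw⟩ := dom_conj_nonempty hg
  apply le_antisymm
  · refine nonpos_of_forall_le_sub_mul (A := ‖vd f g‖ ^ 2) (B := inner ℝ (u + w) (vd f g))
      fun t ht => ?_
    have hmem : u - t • vp f g ∈ dom (conj f) :=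
      sub_smul_mem_dom_conj hf (β := ‖vp f g‖ ^ 2 + inner ℝ b (vp f g)) (fun x hx => by
        have := norm_vp_sq_le_inner hf hg (subset_closure (Set.sub_mem_sub hx hb))
        rw [inner_sub_left] at this
        linarith) hu ht
    have := norm_vd_sq_le_inner hf hg (subset_closure (Set.add_mem_add hmem hw))
    rw [inner_add_left, inner_sub_left, real_inner_smul_left] at this
    rw [inner_add_left]
    linarith
  · rw [← neg_nonpos]
    refine nonpos_of_forall_le_sub_mul (A := ‖vd f g‖ ^ 2) (B := inner ℝ (u + w) (vd f g))
      fun t ht => ?_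
    have hmem : w - t • (-vp f g) ∈ dom (conj g) :=
      sub_smul_mem_dom_conj hg (β := ‖vp f g‖ ^ 2 - inner ℝ a (vp f g)) (fun x hx => by
        have := norm_vp_sq_le_inner hf hg (subset_closure (Set.sub_mem_sub ha hx))
        rw [inner_sub_left] at this
        rw [inner_neg_right]
        linarith) hw ht
    have := norm_vd_sq_le_inner hf hg (subset_closure (Set.add_mem_add hu hmem))
    rw [inner_add_left, inner_sub_left, real_inner_smul_left, inner_neg_left] at this
    rw [inner_add_left]
    linarith

/-! ### The Douglas–Rachford operator -/

/-- The reflected proximal point `prox_g (2 prox_f s - s)`. -/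
def reflProx (f g : H → EReal) (s : H) : H := prox g ((2 : ℝ) • prox f s - s)

/-- The Douglas–Rachford operator. -/
def drStep (f g : H → EReal) (s : H) : H := s + reflProx f g s - prox f s

theorem sub_drStep (f g : H → EReal) (s : H) :
    s - drStep f g s = prox f s - reflProx f g s := by
  rw [drStep]; abel

theorem isSubgrad_reflProx [FiniteDimensional ℝ H] (f : H → EReal) {g : H → EReal}
    (hg : IsProperLscConvex g) (s : H) :
    IsSubgrad g (reflProx f g s) ((2 : ℝ) • prox f s - s - reflProx f g s) :=
  isSubgrad_prox hg _

theorem sub_drStep_mem_dom_sub [FiniteDimensional ℝ H] {f g : H → EReal}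
    (hf : IsProperLscConvex f) (hg : IsProperLscConvex g) (s : H) :
    s - drStep f g s ∈ dom f - dom g := by
  rw [sub_drStep]
  exact Set.sub_mem_sub (isSubgrad_prox hf s).1 (isSubgrad_reflProx f hg s).1

theorem sub_drStep_mem_dom_conj_add [FiniteDimensional ℝ H] {f g : H → EReal}
    (hf : IsProperLscConvex f) (hg : IsProperLscConvex g) (s : H) :
    s - drStep f g s ∈ dom (conj f) + dom (conj g) := by
  have h : s - drStep f g s
      = (s - prox f s) + ((2 : ℝ) • prox f s - s - reflProx f g s) := by
    rw [sub_drStep]; module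
  rw [h]
  exact Set.add_mem_add ((isSubgrad_prox hf s).mem_dom_conj hf)
    ((isSubgrad_reflProx f hg s).mem_dom_conj hg)

/-- The Douglas–Rachford operator is firmly nonexpansive, with the monotonicity gap of the
subdifferential of `f` as an additional term. -/
theorem drStep_firm [FiniteDimensional ℝ H] (f : H → EReal) {g : H → EReal}
    (hg : IsProperLscConvex g) (s t : H) :
    ‖drStep f g s - drStep f g t‖ ^ 2 + ‖(s - drStep f g s) - (t - drStep f g t)‖ ^ 2
      + 2 * inner ℝ (prox f s - prox f t) ((s - prox f s) - (t - prox f t)) ≤ ‖s - t‖ ^ 2 := by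
  have hmono := (isSubgrad_reflProx f hg s).inner_sub_nonneg (isSubgrad_reflProx f hg t)
  set a := prox f s - prox f t with ha
  set b := (s - prox f s) - (t - prox f t) with hb
  set c := reflProx f g s - reflProx f g t with hc
  have h1 : drStep f g s - drStep f g t = c + b := by rw [hb, hc, drStep, drStep]; abel
  have h2 : (s - drStep f g s) - (t - drStep f g t) = a - c := by
    rw [sub_drStep, sub_drStep, ha, hc]; abel
  have h3 : s - t = a + b := by rw [ha, hb]; abel
  have h4 : (2 : ℝ) • prox f s - s - reflProx f g s - ((2 : ℝ) • prox f t - t - reflProx f g t)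
      = a - b - c := by rw [ha, hb, hc]; module
  rw [h4, inner_sub_right, inner_sub_right, real_inner_self_eq_norm_sq] at hmono
  rw [h1, h2, h3, norm_add_sq_real c, norm_add_sq_real a, norm_sub_sq_real a]
  rw [real_inner_comm] at hmono
  linarith

theorem inner_prox_sub_nonneg [FiniteDimensional ℝ H] {f : H → EReal}
    (hf : IsProperLscConvex f) (s t : H) :
    0 ≤ inner ℝ (prox f s - prox f t) ((s - prox f s) - (t - prox f t)) :=
  (isSubgrad_prox hf s).inner_sub_nonneg (isSubgrad_prox hf t)

theorem norm_prox_sub_le [FiniteDimensional ℝ H] {f : H → EReal}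
    (hf : IsProperLscConvex f) (s t : H) : ‖prox f s - prox f t‖ ≤ ‖s - t‖ := by
  have h := inner_prox_sub_nonneg hf s t
  have h3 : s - t = (prox f s - prox f t) + ((s - prox f s) - (t - prox f t)) := by abel
  refine le_of_sq_le_sq ?_ (norm_nonneg _)
  rw [h3, norm_add_sq_real]
  nlinarith [sq_nonneg ‖(s - prox f s) - (t - prox f t)‖]

theorem norm_drStep_sub_le [FiniteDimensional ℝ H] {f g : H → EReal}
    (hf : IsProperLscConvex f) (hg : IsProperLscConvex g) (s t : H) :
    ‖drStep f g s - drStep f g t‖ ≤ ‖s - t‖ := by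
  have h := drStep_firm f hg s t
  have h1 := inner_prox_sub_nonneg hf s t
  refine le_of_sq_le_sq ?_ (norm_nonneg _)
  nlinarith [sq_nonneg ‖(s - drStep f g s) - (t - drStep f g t)‖]

/-! ### The displacement `v_p + v_d` is approximately attained -/

/-- `T / (1 + δ)` is a contraction for the Douglas–Rachford operator `T`; its fixed point `s`
satisfies `s - T s = -δ s`. -/
theorem exists_sub_drStep_eq_neg_smul [FiniteDimensional ℝ H] {f g : H → EReal}
    (hf : IsProperLscConvex f) (hg : IsProperLscConvex g) {δ : ℝ} (hδ : 0 < δ) :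
    ∃ s : H, s - drStep f g s = -(δ • s) ∧ ‖δ • s‖ ≤ ‖drStep f g 0‖ := by
  have hpos : 0 < 1 + δ := by linarith
  have hcontr : ContractingWith (Real.toNNReal (1 + δ)⁻¹) (fun s => (1 + δ)⁻¹ • drStep f g s) := by
    refine ⟨?_, LipschitzWith.of_dist_le_mul fun s t => ?_⟩
    · rw [Real.toNNReal_lt_one]
      exact inv_lt_one_of_one_lt₀ (by linarith)
    · rw [Real.coe_toNNReal _ (inv_nonneg.2 hpos.le), dist_eq_norm, dist_eq_norm, ← smul_sub,
        norm_smul, Real.norm_of_nonneg (inv_nonneg.2 hpos.le)]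
      exact mul_le_mul_of_nonneg_left (norm_drStep_sub_le hf hg s t) (inv_nonneg.2 hpos.le)
  obtain ⟨s, hs⟩ : ∃ s, (1 + δ)⁻¹ • drStep f g s = s :=
    ⟨_, hcontr.fixedPoint_isFixedPt⟩
  have hT : drStep f g s = (1 + δ) • s := by
    nth_rw 2 [← hs]
    rw [smul_inv_smul₀ hpos.ne']
  refine ⟨s, by rw [hT]; module, ?_⟩
  have h1 := norm_drStep_sub_le hf hg s 0
  have h2 := norm_sub_norm_le (drStep f g s) (drStep f g 0)
  rw [sub_zero] at h1
  rw [norm_smul, Real.norm_of_nonneg hδ.le]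
  have h3 : ‖drStep f g s‖ = (1 + δ) * ‖s‖ := by
    rw [hT, norm_smul, Real.norm_of_nonneg hpos.le]
  linarith

theorem exists_regularized_seq [FiniteDimensional ℝ H] {f g : H → EReal}
    (hf : IsProperLscConvex f) (hg : IsProperLscConvex g) :
    ∃ (s : ℕ → H) (δ : ℕ → ℝ) (σ p : H), (∀ k, 0 < δ k) ∧ Tendsto δ atTop (𝓝 0) ∧
      (∀ k, s k - drStep f g (s k) = -(δ k • s k)) ∧
      Tendsto (fun k => δ k • s k) atTop (𝓝 σ) ∧
      Tendsto (fun k => δ k • prox f (s k)) atTop (𝓝 p) := by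
  have hδ : ∀ k : ℕ, (0 : ℝ) < 1 / ((k : ℝ) + 1) := fun k => by positivity
  choose s hs hsb using fun k : ℕ => exists_sub_drStep_eq_neg_smul hf hg (hδ k)
  set M := ‖drStep f g 0‖ with hM
  have hpb : ∀ k : ℕ, ‖(1 / ((k : ℝ) + 1)) • prox f (s k)‖ ≤ M + ‖prox f 0‖ := by
    intro k
    have h1 := norm_prox_sub_le hf (s k) 0
    have h2 := norm_sub_norm_le (prox f (s k)) (prox f 0)
    rw [sub_zero] at h1
    have h3 := hsb k
    have h4 : (1 : ℝ) / ((k : ℝ) + 1) ≤ 1 := by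
      rw [div_le_one (by positivity)]
      linarith [(Nat.cast_nonneg k : (0 : ℝ) ≤ k)]
    rw [norm_smul, Real.norm_of_nonneg (hδ k).le] at h3 ⊢
    nlinarith [mul_le_mul_of_nonneg_left (h2.trans h1) (hδ k).le,
      mul_le_mul_of_nonneg_right h4 (norm_nonneg (prox f 0))]
  obtain ⟨⟨σ, p⟩, -, φ, hφ, hlim⟩ := tendsto_subseq_of_bounded
    (s := Metric.closedBall (0 : H) M ×ˢ Metric.closedBall (0 : H) (M + ‖prox f 0‖))
    (Metric.isBounded_closedBall.prod Metric.isBounded_closedBall)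
    (x := fun k => ((1 / ((k : ℝ) + 1)) • s k, (1 / ((k : ℝ) + 1)) • prox f (s k)))
    (fun k => ⟨by simpa using hsb k, by simpa using hpb k⟩)
  exact ⟨fun k => s (φ k), fun k => 1 / ((φ k : ℝ) + 1), σ, p, fun k => hδ _,
    tendsto_one_div_add_atTop_nhds_zero_nat.comp hφ.tendsto_atTop, fun k => hs _,
    (continuous_fst.tendsto _).comp hlim, (continuous_snd.tendsto _).comp hlim⟩

/-- The limit form of the monotonicity inequalities for `f` and `g` along the regularized points.
Fixed test points `(a, u)`, `(b, w)` only contribute through `d = a - b` and `r = u + w`, because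
everything else is of lower order; this lets `d` and `r` range over the two closures
independently of each other. -/
theorem regularized_limit_ineq [FiniteDimensional ℝ H] {f g : H → EReal}
    (hf : IsProperLscConvex f) (hg : IsProperLscConvex g) {s : ℕ → H} {δ : ℕ → ℝ} {σ p : H}
    (hδ : ∀ k, 0 < δ k) (hδ0 : Tendsto δ atTop (𝓝 0))
    (hz : ∀ k, s k - drStep f g (s k) = -(δ k • s k))
    (hσ : Tendsto (fun k => δ k • s k) atTop (𝓝 σ))
    (hp : Tendsto (fun k => δ k • prox f (s k)) atTop (𝓝 p)) {d r : H}
    (hd : d ∈ closure (dom f - dom g)) (hr : r ∈ closure (dom (conj f) + dom (conj g))) :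
    0 ≤ inner ℝ (-p) (r + σ) + inner ℝ (d + σ) (p - σ) := by
  have base : ∀ d ∈ dom f - dom g, ∀ r ∈ dom (conj f) + dom (conj g),
      0 ≤ inner ℝ (-p) (r + σ) + inner ℝ (d + σ) (p - σ) := by
    rintro _ ⟨a, ha, b, hb, rfl⟩ _ ⟨u, hu, w, hw, rfl⟩
    dsimp only
    obtain ⟨C, hC⟩ := exists_le_inner_sub hf ha hu
    obtain ⟨E, hE⟩ := exists_le_inner_sub hg hb hw
    have hineq : ∀ k, δ k * (C + E) ≤
        inner ℝ (δ k • a - δ k • prox f (s k)) (u + w + δ k • s k)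
        + inner ℝ (a - b + δ k • s k) (δ k • u - (δ k • s k - δ k • prox f (s k)))
        - δ k * inner ℝ (a - b + δ k • s k) (u + w + δ k • s k) := by
      intro k
      have h1 := hC _ _ (isSubgrad_prox hf (s k))
      have h2 := hE _ _ (isSubgrad_reflProx f hg (s k))
      have h3 := hz k
      rw [sub_drStep] at h3
      have hY : reflProx f g (s k) = prox f (s k) + δ k • s k := by
        rw [← neg_eq_iff_eq_neg.2 h3]; abel
      set e := δ k • s k
      set A := a - prox f (s k) with hA
      set B := u - (s k - prox f (s k)) with hB
      have e1 : b - reflProx f g (s k) = A - (a - b + e) := by rw [hY, hA]; abel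
      have e2 : w - ((2 : ℝ) • prox f (s k) - s k - reflProx f g (s k)) = (u + w + e) - B := by
        rw [hY, hB]; module
      rw [e1, e2] at h2
      have e3 : δ k • a - δ k • prox f (s k) = δ k • A := by rw [hA, smul_sub]
      have e4 : δ k • u - (e - δ k • prox f (s k)) = δ k • B := by
        simp only [hB, e]; module
      rw [e3, e4, real_inner_smul_left, real_inner_smul_right, ← mul_add, ← mul_sub]
      refine mul_le_mul_of_nonneg_left ?_ (hδ k).le
      rw [inner_sub_left, inner_sub_right A, inner_sub_right (a - b + e)] at h2
      linarith
    have hlim1 : Tendsto (fun k => δ k * (C + E)) atTop (𝓝 0) := by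
      simpa using hδ0.mul_const (C + E)
    have hR : Tendsto (fun k => u + w + δ k • s k) atTop (𝓝 (u + w + σ)) := hσ.const_add _
    have hD : Tendsto (fun k => a - b + δ k • s k) atTop (𝓝 (a - b + σ)) := hσ.const_add _
    have hδa : ∀ y : H, Tendsto (fun k => δ k • y) atTop (𝓝 0) := fun y => by
      simpa using hδ0.smul_const y
    have hlim2 := ((((hδa a).sub hp).inner (𝕜 := ℝ) hR).add
      (hD.inner (𝕜 := ℝ) ((hδa u).sub (hσ.sub hp)))).sub (hδ0.mul (hD.inner (𝕜 := ℝ) hR))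
    have := le_of_tendsto_of_tendsto' hlim1 hlim2 hineq
    simpa using this
  have step1 : ∀ r ∈ dom (conj f) + dom (conj g),
      0 ≤ inner ℝ (-p) (r + σ) + inner ℝ (d + σ) (p - σ) := fun r hr =>
    closure_minimal (t := {d | 0 ≤ inner ℝ (-p) (r + σ) + inner ℝ (d + σ) (p - σ)})
      (fun d hd => base d hd r hr) (isClosed_le (by fun_prop) (by fun_prop)) hd
  exact closure_minimal (t := {r | 0 ≤ inner ℝ (-p) (r + σ) + inner ℝ (d + σ) (p - σ)})
    step1 (isClosed_le (by fun_prop) (by fun_prop)) hr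

/-- If `δ k → 0⁺`, `δ k x k → l`, and `⟪·, v⟫` is bounded below along `x`, then
`0 ≤ ⟪l, v⟫`. -/
theorem inner_nonneg_of_tendsto_smul {x : ℕ → H} {δ : ℕ → ℝ} {l v : H} {c : ℝ}
    (hδ : ∀ k, 0 < δ k) (hδ0 : Tendsto δ atTop (𝓝 0))
    (hx : Tendsto (fun k => δ k • x k) atTop (𝓝 l)) (hc : ∀ k, c ≤ inner ℝ (x k) v) :
    0 ≤ inner ℝ l v := by
  have h1 : Tendsto (fun k => δ k * c) atTop (𝓝 0) := by simpa using hδ0.mul_const c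
  refine le_of_tendsto_of_tendsto' h1 (hx.inner (𝕜 := ℝ) tendsto_const_nhds) fun k => ?_
  rw [real_inner_smul_left]
  exact mul_le_mul_of_nonneg_left (hc k) (hδ k).le

theorem norm_add_sq_le_inner_of_mem [FiniteDimensional ℝ H] {f g : H → EReal}
    (hf : IsProperLscConvex f) (hg : IsProperLscConvex g) {z : H}
    (hd : z ∈ closure (dom f - dom g)) (hr : z ∈ closure (dom (conj f) + dom (conj g))) :
    ‖vp f g + vd f g‖ ^ 2 ≤ inner ℝ z (vp f g + vd f g) := by
  have h1 := norm_vp_sq_le_inner hf hg hd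
  have h2 := norm_vd_sq_le_inner hf hg hr
  rw [norm_add_sq_real, inner_vp_vd hf hg, inner_add_right]
  linarith

theorem sub_drStep_inner [FiniteDimensional ℝ H] {f g : H → EReal}
    (hf : IsProperLscConvex f) (hg : IsProperLscConvex g) (s : H) :
    ‖vp f g + vd f g‖ ^ 2 ≤ inner ℝ (s - drStep f g s) (vp f g + vd f g) :=
  norm_add_sq_le_inner_of_mem hf hg (subset_closure (sub_drStep_mem_dom_sub hf hg s))
    (subset_closure (sub_drStep_mem_dom_conj_add hf hg s))

/-- The vector `v_p + v_d` lies in the closure of the range of `Id - T`: the displacements at the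
regularized points converge to it. -/
theorem exists_seq_sub_drStep_tendsto [FiniteDimensional ℝ H] {f g : H → EReal}
    (hf : IsProperLscConvex f) (hg : IsProperLscConvex g) :
    ∃ s : ℕ → H, Tendsto (fun k => s k - drStep f g (s k)) atTop (𝓝 (vp f g + vd f g)) := by
  obtain ⟨s, δ, σ, p, hδ, hδ0, hz, hσ, hp⟩ := exists_regularized_seq hf hg
  have hzlim : Tendsto (fun k => s k - drStep f g (s k)) atTop (𝓝 (-σ)) := by
    simp only [hz]
    exact hσ.neg
  have hvp : vp f g ∈ closure (dom f - dom g) := (proj_zero_spec isClosed_closure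
    (hf.dom_nonempty.sub hg.dom_nonempty).closure).1
  have hvd : vd f g ∈ closure (dom (conj f) + dom (conj g)) := (proj_zero_spec isClosed_closure
    ((dom_conj_nonempty hf).add (dom_conj_nonempty hg)).closure).1
  have hmain := regularized_limit_ineq hf hg hδ hδ0 hz hσ hp hvp hvd
  have hw := norm_add_sq_le_inner_of_mem hf hg
    (mem_closure_of_tendsto hzlim (Eventually.of_forall fun k => sub_drStep_mem_dom_sub hf hg _))
    (mem_closure_of_tendsto hzlim
      (Eventually.of_forall fun k => sub_drStep_mem_dom_conj_add hf hg _))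
  obtain ⟨a, ha⟩ := hf.dom_nonempty
  obtain ⟨b, hb⟩ := hg.dom_nonempty
  obtain ⟨u, hu⟩ := dom_conj_nonempty hf
  have hδz : Tendsto (fun k => δ k • (s k - drStep f g (s k))) atTop (𝓝 0) := by
    simpa using hδ0.smul hzlim
  -- `⟪·, v_p⟫` is bounded below along `prox f (s k)` and above along `reflProx f g (s k)`, and
  -- these two sequences have the same limit `p` after multiplication by `δ k`. Of the resulting
  -- equality `⟪p, v_p⟫ = 0` one inequality is enough; `hq1` is its counterpart for `v_d`.
  have hp0 : inner ℝ p (vp f g) ≤ 0 := by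
    have hY : Tendsto (fun k => δ k • (-reflProx f g (s k))) atTop (𝓝 (-p)) := by
      have := hδz.sub hp
      rw [zero_sub] at this
      refine this.congr fun k => ?_
      rw [sub_drStep]; module
    have := inner_nonneg_of_tendsto_smul (v := vp f g)
      (c := ‖vp f g‖ ^ 2 - inner ℝ a (vp f g)) hδ hδ0 hY fun k => by
        have := norm_vp_sq_le_inner hf hg
          (subset_closure (Set.sub_mem_sub ha (isSubgrad_reflProx f hg (s k)).1))
        rw [inner_sub_left] at this
        rw [inner_neg_left]
        linarith
    rwa [inner_neg_left, neg_nonneg] at this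
  have hq1 : inner ℝ (σ - p) (vd f g) ≤ 0 := by
    have hW : Tendsto (fun k => δ k • ((2 : ℝ) • prox f (s k) - s k - reflProx f g (s k))) atTop
        (𝓝 (-(σ - p))) := by
      have := hδz.sub (hσ.sub hp)
      rw [zero_sub] at this
      refine this.congr fun k => ?_
      rw [sub_drStep]; module
    have := inner_nonneg_of_tendsto_smul (v := vd f g)
      (c := ‖vd f g‖ ^ 2 - inner ℝ u (vd f g)) hδ hδ0 hW fun k => by
        have := norm_vd_sq_le_inner hf hg (subset_closure
          (Set.add_mem_add hu ((isSubgrad_reflProx f hg (s k)).mem_dom_conj hg)))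
        rw [inner_add_left] at this
        linarith
    rwa [inner_neg_left, neg_nonneg] at this
  have heq : -σ = vp f g + vd f g := by
    rw [← sub_eq_zero, ← norm_eq_zero, ← sq_eq_zero_iff]
    refine le_antisymm ?_ (sq_nonneg _)
    rw [inner_sub_left] at hq1
    rw [inner_neg_left, inner_add_right, inner_add_left (vp f g), inner_sub_right, inner_sub_right,
      real_inner_self_eq_norm_sq, real_inner_comm σ p, real_inner_comm p (vp f g),
      real_inner_comm σ (vp f g)] at hmain
    rw [norm_sub_sq_real, norm_neg]
    rw [inner_neg_left, inner_add_right] at hw ⊢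
    linarith
  exact ⟨s, heq ▸ hzlim⟩

/-! ### Convergence of the displacements -/

/-- The displacements along any two orbits are asymptotically equal: by firm nonexpansiveness the
squared norm of their difference is at most the decrease of `‖s n - t n‖²`. -/
theorem tendsto_sub_drStep_sub [FiniteDimensional ℝ H] {f g : H → EReal}
    (hf : IsProperLscConvex f) (hg : IsProperLscConvex g) {s t : ℕ → H}
    (hs : ∀ n, s (n + 1) = drStep f g (s n)) (ht : ∀ n, t (n + 1) = drStep f g (t n)) :
    Tendsto (fun n => (s n - drStep f g (s n)) - (t n - drStep f g (t n))) atTop (𝓝 0) := by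
  have hstep : ∀ n, ‖(s n - drStep f g (s n)) - (t n - drStep f g (t n))‖ ^ 2
      ≤ ‖s n - t n‖ ^ 2 - ‖s (n + 1) - t (n + 1)‖ ^ 2 := by
    intro n
    have h1 := drStep_firm f hg (s n) (t n)
    have h2 := inner_prox_sub_nonneg hf (s n) (t n)
    rw [hs, ht]
    linarith
  have hanti : Antitone fun n => ‖s n - t n‖ ^ 2 :=
    antitone_nat_of_succ_le fun n => by
      have := hstep n
      have := sq_nonneg ‖(s n - drStep f g (s n)) - (t n - drStep f g (t n))‖
      linarith
  have hlim := tendsto_atTop_ciInf hanti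
    ⟨0, by rintro _ ⟨n, rfl⟩; exact sq_nonneg ‖s n - t n‖⟩
  have hdiff := hlim.sub (hlim.comp (tendsto_add_atTop_nat 1))
  rw [sub_self] at hdiff
  have hsq := squeeze_zero (fun n => sq_nonneg _) hstep hdiff
  rw [tendsto_zero_iff_norm_tendsto_zero]
  simpa using hsq.sqrt

theorem norm_sub_drStep_le [FiniteDimensional ℝ H] {f g : H → EReal}
    (hf : IsProperLscConvex f) (hg : IsProperLscConvex g) {t : ℕ → H}
    (ht : ∀ n, t (n + 1) = drStep f g (t n)) (n : ℕ) :
    ‖t n - drStep f g (t n)‖ ≤ ‖t 0 - drStep f g (t 0)‖ := by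
  induction n with
  | zero => exact le_rfl
  | succ n ih =>
    refine le_trans ?_ ih
    have := norm_drStep_sub_le hf hg (t n) (drStep f g (t n))
    rwa [← ht n] at this ⊢

/-- The displacements of any orbit converge to `v_p + v_d`. They share their limit behaviour with
the orbit of a point whose displacement is close to `v_p + v_d`, and on such an orbit the
displacement stays close to `v_p + v_d` because its norm cannot increase. -/
theorem tendsto_sub_drStep [FiniteDimensional ℝ H] {f g : H → EReal}
    (hf : IsProperLscConvex f) (hg : IsProperLscConvex g) {s : ℕ → H}
    (hs : ∀ n, s (n + 1) = drStep f g (s n)) :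
    Tendsto (fun n => s n - drStep f g (s n)) atTop (𝓝 (vp f g + vd f g)) := by
  set v := vp f g + vd f g with hv
  obtain ⟨r, hr⟩ := exists_seq_sub_drStep_tendsto hf hg
  rw [Metric.tendsto_atTop]
  intro ε hε
  have hr2 : Tendsto (fun k => ‖r k - drStep f g (r k)‖ ^ 2) atTop (𝓝 (‖v‖ ^ 2)) :=
    hr.norm.pow 2
  obtain ⟨k, hk⟩ := (hr2.eventually_lt_const
    (show ‖v‖ ^ 2 < ‖v‖ ^ 2 + (ε / 2) ^ 2 by have := pow_pos (half_pos hε) 2; linarith)).exists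
  let t : ℕ → H := fun n => (drStep f g)^[n] (r k)
  have ht : ∀ n, t (n + 1) = drStep f g (t n) := fun n => Function.iterate_succ_apply' _ _ _
  have hclose : ∀ n, ‖(t n - drStep f g (t n)) - v‖ < ε / 2 := by
    intro n
    have h1 := norm_sub_drStep_le hf hg ht n
    have h2 := sub_drStep_inner hf hg (t n)
    have h3 := pow_le_pow_left₀ (norm_nonneg _) h1 2
    have h0 : t 0 = r k := rfl
    rw [h0] at h3
    refine lt_of_pow_lt_pow_left₀ 2 (half_pos hε).le ?_
    rw [norm_sub_sq_real]
    linarith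
  obtain ⟨N, hN⟩ := Metric.tendsto_atTop.1 (tendsto_sub_drStep_sub hf hg hs ht) (ε / 2)
    (half_pos hε)
  refine ⟨N, fun n hn => ?_⟩
  have h1 := hN n hn
  have h2 := hclose n
  rw [dist_zero_right] at h1
  rw [dist_eq_norm]
  have h3 := norm_sub_le_norm_sub_add_norm_sub (s n - drStep f g (s n)) (t n - drStep f g (t n)) v
  linarith

/-! ### Splitting the displacement -/

/-- If `c` bounds all the sums `p m + q n` from below and `p n + q n → c`, then the increments of
`p` tend to zero. -/
theorem tendsto_sub_succ_zero {p q : ℕ → ℝ} {c : ℝ} (hc : ∀ m n, c ≤ p m + q n)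
    (h : Tendsto (fun n => p n + q n) atTop (𝓝 c)) :
    Tendsto (fun n => p n - p (n + 1)) atTop (𝓝 0) := by
  have h1 : Tendsto (fun n => p n + q n - c) atTop (𝓝 0) := by simpa using h.sub_const c
  have h2 : Tendsto (fun n => -(p (n + 1) + q (n + 1) - c)) atTop (𝓝 0) := by
    simpa using (h1.comp (tendsto_add_atTop_nat 1)).neg
  exact tendsto_of_tendsto_of_tendsto_of_le_of_le h2 h1
    (fun n => by have := hc n (n + 1); dsimp only; linarith)
    (fun n => by have := hc (n + 1) n; dsimp only; linarith)

theorem tendsto_prox_sub [FiniteDimensional ℝ H] {f g : H → EReal}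
    (hf : IsProperLscConvex f) (hg : IsProperLscConvex g) {s : ℕ → H}
    (hs : ∀ n, s (n + 1) = drStep f g (s n)) :
    Tendsto (fun n => prox f (s n) - prox f (s (n + 1))) atTop (𝓝 (vd f g)) := by
  have hz := tendsto_sub_drStep hf hg hs
  have horth := inner_vp_vd hf hg
  set z : ℕ → H := fun n => s n - drStep f g (s n) with hz_def
  set a : ℕ → H := fun n => prox f (s n) - prox f (s (n + 1)) with ha
  set b : ℕ → H := fun n => (s n - prox f (s n)) - (s (n + 1) - prox f (s (n + 1))) with hb
  have hab : ∀ n, a n + b n = z n := fun n => by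
    simp only [ha, hb, hz_def, ← hs]; abel
  -- `⟪a n, b n⟫` is controlled by the decrease of `‖z n‖²`.
  have hinner : Tendsto (fun n => inner ℝ (a n) (b n)) atTop (𝓝 0) := by
    have h1 : Tendsto (fun n => ‖z n‖ ^ 2 - ‖z (n + 1)‖ ^ 2) atTop (𝓝 0) := by
      have h2 := hz.norm.pow 2
      simpa using h2.sub (h2.comp (tendsto_add_atTop_nat 1))
    refine squeeze_zero (fun n => inner_prox_sub_nonneg hf _ _) (fun n => ?_) h1
    have h2 := drStep_firm f hg (s n) (s (n + 1))
    have h3 := inner_prox_sub_nonneg hf (s n) (s (n + 1))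
    have h4 := sq_nonneg ‖(s n - drStep f g (s n)) - (s (n + 1) - drStep f g (s (n + 1)))‖
    have h5 : ‖drStep f g (s n) - drStep f g (s (n + 1))‖ = ‖z (n + 1)‖ := by
      rw [← hs n]
    have h6 : ‖s n - s (n + 1)‖ = ‖z n‖ := by rw [hs n]
    rw [h5, h6] at h2
    linarith
  have hap : Tendsto (fun n => inner ℝ (a n) (vp f g)) atTop (𝓝 0) := by
    have := tendsto_sub_succ_zero (p := fun n => inner ℝ (prox f (s n)) (vp f g))
      (q := fun n => -inner ℝ (reflProx f g (s n)) (vp f g)) (c := ‖vp f g‖ ^ 2)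
      (fun m n => by
        have := norm_vp_sq_le_inner hf hg (subset_closure
          (Set.sub_mem_sub (isSubgrad_prox hf (s m)).1 (isSubgrad_reflProx f hg (s n)).1))
        rw [inner_sub_left] at this
        linarith)
      (by
        have := hz.inner (𝕜 := ℝ) (tendsto_const_nhds (x := vp f g))
        rw [inner_add_left, real_inner_self_eq_norm_sq, real_inner_comm, horth, add_zero] at this
        refine this.congr fun n => ?_
        simp only [hz_def]
        rw [sub_drStep, inner_sub_left, sub_eq_add_neg])
    simpa only [ha, inner_sub_left] using this
  have hbd : Tendsto (fun n => inner ℝ (b n) (vd f g)) atTop (𝓝 0) := by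
    have := tendsto_sub_succ_zero (p := fun n => inner ℝ (s n - prox f (s n)) (vd f g))
      (q := fun n => inner ℝ ((2 : ℝ) • prox f (s n) - s n - reflProx f g (s n)) (vd f g))
      (c := ‖vd f g‖ ^ 2)
      (fun m n => by
        have := norm_vd_sq_le_inner hf hg (subset_closure
          (Set.add_mem_add ((isSubgrad_prox hf (s m)).mem_dom_conj hf)
            ((isSubgrad_reflProx f hg (s n)).mem_dom_conj hg)))
        rwa [inner_add_left] at this)
      (by
        have := hz.inner (𝕜 := ℝ) (tendsto_const_nhds (x := vd f g))
        rw [inner_add_left, real_inner_self_eq_norm_sq, horth, zero_add] at this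
        refine this.congr fun n => ?_
        simp only [hz_def]
        rw [sub_drStep, ← inner_add_left]
        congr 1
        module)
    simp only [hb]
    refine this.congr fun n => ?_
    rw [inner_sub_left (s n - prox f (s n))]
  have had : Tendsto (fun n => inner ℝ (a n) (vd f g)) atTop (𝓝 (‖vd f g‖ ^ 2)) := by
    have h1 := (hz.inner (𝕜 := ℝ) (tendsto_const_nhds (x := vd f g))).sub hbd
    rw [inner_add_left, real_inner_self_eq_norm_sq, horth, zero_add, sub_zero] at h1
    refine h1.congr fun n => ?_
    rw [← hab, inner_add_left, add_sub_cancel_right]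
  -- `a` is bounded, so `⟪a n, z n⟫` and `⟪a n, v_p + v_d⟫` have the same limit.
  have haz : Tendsto (fun n => inner ℝ (a n) (z n - (vp f g + vd f g))) atTop (𝓝 0) := by
    obtain ⟨M, hM⟩ := hz.norm.bddAbove_range
    have hle : ∀ n, ‖a n‖ ≤ M := fun n => by
      have h1 := norm_prox_sub_le hf (s n) (s (n + 1))
      have h2 : ‖s n - s (n + 1)‖ ≤ M := by
        rw [hs]
        exact hM ⟨n, rfl⟩
      exact h1.trans h2
    have h0 : Tendsto (fun n => M * ‖z n - (vp f g + vd f g)‖) atTop (𝓝 0) := by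
      simpa using (hz.sub_const (vp f g + vd f g)).norm.const_mul M
    refine squeeze_zero_norm (fun n => ?_) h0
    exact (norm_inner_le_norm _ _).trans (mul_le_mul_of_nonneg_right (hle n) (norm_nonneg _))
  have hsq : Tendsto (fun n => ‖a n - vd f g‖ ^ 2) atTop (𝓝 0) := by
    have h1 := ((((haz.add hap).add had).sub hinner).sub (had.const_mul 2)).add_const
      (‖vd f g‖ ^ 2)
    have h2 : (0 : ℝ) + 0 + ‖vd f g‖ ^ 2 - 0 - 2 * ‖vd f g‖ ^ 2 + ‖vd f g‖ ^ 2 = 0 := by ring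
    rw [h2] at h1
    refine h1.congr fun n => ?_
    rw [norm_sub_sq_real, ← hab, inner_sub_right, inner_add_right, inner_add_right,
      real_inner_self_eq_norm_sq]
    ring
  rw [tendsto_iff_norm_sub_tendsto_zero]
  simpa using hsq.sqrt

end DouglasRachford

end

theorem mainTheorem2 {H : Type*} [NormedAddCommGroup H] [InnerProductSpace ℝ H]
    [FiniteDimensional ℝ H] (f g : H → EReal)
    (hf : DouglasRachford.IsProperLscConvex f) (hg : DouglasRachford.IsProperLscConvex g)
    (s x ν x' : ℕ → H)
    (hx : ∀ n, x n = DouglasRachford.prox f (s n))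
    (hν : ∀ n, ν n = s n - x n)
    (hx' : ∀ n, x' n = DouglasRachford.prox g ((2 : ℝ) • x n - s n))
    (hs : ∀ n, s (n + 1) = s n + x' n - x n) :
    Tendsto (fun n => x n - x (n + 1)) atTop (𝓝 (DouglasRachford.vd f g)) ∧
    Tendsto (fun n => x' n - x' (n + 1)) atTop (𝓝 (DouglasRachford.vd f g)) ∧
    Tendsto (fun n => ν n - ν (n + 1)) atTop (𝓝 (DouglasRachford.vp f g)) ∧
    (DouglasRachford.vp f g ≠ 0 → DouglasRachford.StronglyInfeasible f g) ∧
    (DouglasRachford.vd f g ≠ 0 →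
      DouglasRachford.StronglyInfeasible (DouglasRachford.conj f)
        (fun ν => DouglasRachford.conj g (-ν))) := by
  have hstep : ∀ n, s (n + 1) = DouglasRachford.drStep f g (s n) := fun n => by
    rw [hs, hx', hx]; rfl
  have hxlim : Tendsto (fun n => x n - x (n + 1)) atTop (𝓝 (DouglasRachford.vd f g)) := by
    simpa only [hx] using DouglasRachford.tendsto_prox_sub hf hg hstep
  have hzlim : Tendsto (fun n => s n - s (n + 1)) atTop
      (𝓝 (DouglasRachford.vp f g + DouglasRachford.vd f g)) := by
    simpa only [hstep] using DouglasRachford.tendsto_sub_drStep hf hg hstep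
  refine ⟨hxlim, ?_, ?_, fun h => DouglasRachford.zero_notMem_of_proj_zero_ne isClosed_closure h,
    fun h => ?_⟩
  · have h1 := hxlim.sub (hzlim.sub (hzlim.comp (tendsto_add_atTop_nat 1)))
    rw [sub_self, sub_zero] at h1
    refine h1.congr fun n => ?_
    simp only [Function.comp_apply, hs]
    abel
  · have h1 := hzlim.sub hxlim
    rw [add_sub_cancel_right] at h1
    refine h1.congr fun n => ?_
    rw [hν, hν]
    abel
  · have hdom : DouglasRachford.dom (fun ν => DouglasRachford.conj g (-ν))
        = -DouglasRachford.dom (DouglasRachford.conj g) := rfl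
    rw [DouglasRachford.StronglyInfeasible, hdom, sub_neg_eq_add]
    exact DouglasRachford.zero_notMem_of_proj_zero_ne isClosed_closure h
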